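/- Let $P=\mathbb{N}^{\mathrm{op}}$ be the set of natural numbers (including $0$) with the opposite of its usual order, regarded as a category with a unique morphism $p\to q$ whenever $p\le q$ in $P$. Let $X$ be the set of filters on $P$ (nonempty, upwards closed, downwards directed subsets), ordered by inclusion and equipped with the Scott topology. Then: 1. $X\cong\mathbb{N}\cup\{\infty\}$ as ordered sets (with the usual order on the right), the principal filter generated by $n$ corresponding to $n$, and the unique non-principal filter, which is $P$ itself, corresponding to $\infty$. 2. $|X| = |P| = \mathbf{cl} = \aleph_0$, where $\mathbf{cl}$ is the number of Grothendieck topologies $J$ on $P$ for which $\mathsf{Sh}(P,J)$ is a closed subtopos of $\mathsf{PSh}(P)$ (that is, for some subterminal presheaf $U$, the $J$-sheaves are exactly the presheaves $F$ for which the projection $F\times U\to U$ is an isomorphism). 3. $\mathbf{gt}=\mathbf{ep}=\mathbf{coh}=2^{\aleph_0}$, where $\mathbf{gt}$ is the cardinality of the set of all Grothendieck topologies on $P$; $\mathbf{ep}$ that of the set of those $J$ for which $\mathsf{Sh}(P,J)$ has enough points; and $\mathbf{coh}$ that of the set of those $J$ for which $\mathsf{Sh}(P,J)$ is a coherent subtopos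 of $\mathsf{PSh}(P)$. Here an object of a topos is compact if every epimorphic family onto it contains a finite epimorphic subfamily, and coherent if it is compact and every pullback over it of two compact objects is compact; a topos is coherent if it has a full subcategory of compact generators closed under finite limits; and $\mathsf{Sh}(P,J)$ is a coherent subtopos if $\mathsf{PSh}(P)$ and $\mathsf{Sh}(P,J)$ are coherent toposes and sheafification $\mathsf{PSh}(P)\to\mathsf{Sh}(P,J)$ preserves coherent objects. 4. $X$ is a spectral space, every open subset of $X$ is compact, and the patch topology on $X$ (generated by the compact open sets and their complements) coincides with the strong topology (generated by the locally closed sets). -/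

import Mathlib

open CategoryTheory CategoryTheory.Limits Cardinal

universe v u

namespace PosetTopos

/-! ### The dcpo of filters and its topologies -/

/-- The poset of filters on `P` (ordered by inclusion) carries the Scott topology. -/
instance filterScottTopology (P : Type u) [PartialOrder P] :
    TopologicalSpace (Order.PFilter P) :=
  Topology.scott (Order.PFilter P) Set.univ

/-- The strong topology on a topological space: the topology generated by the locally closed
sets, i.e. the intersections of an open and a closed set. -/
@[reducible]
def strongTopology (X : Type u) [TopologicalSpace X] : TopologicalSpace X :=
  TopologicalSpace.generateFrom {s : Set X | IsLocallyClosed s}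

/-- The patch topology on a topological space: the topology generated by the compact open sets
and their complements. -/
@[reducible]
def patchTopology (X : Type u) [TopologicalSpace X] : TopologicalSpace X :=
  TopologicalSpace.generateFrom
    ({s : Set X | IsOpen s ∧ IsCompact s} ∪ {s : Set X | IsOpen sᶜ ∧ IsCompact sᶜ})

/-! ### Compact and coherent objects, coherent toposes -/

section Topos

variable {E : Type u} [Category.{v} E]

/-- A family of morphisms with common codomain `X` is epimorphic. -/
def EpimorphicFamily {X : E} {ι : Type v} {Y : ι → E} (f : ∀ i, Y i ⟶ X) : Prop :=
  ∀ ⦃Z : E⦄ (g h : X ⟶ Z), (∀ i, f i ≫ g = f i ≫ h) → g = h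

/-- An object `X` is compact if every epimorphic family with codomain `X` contains a finite
epimorphic subfamily. -/
def IsCompactObject (X : E) : Prop :=
  ∀ ⦃ι : Type v⦄ ⦃Y : ι → E⦄ (f : ∀ i, Y i ⟶ X), EpimorphicFamily f →
    ∃ s : Finset ι, EpimorphicFamily (fun i : {i : ι // i ∈ s} => f i.1)

/-- An object `X` is coherent if it is compact and every diagram `Y ⟶ X ⟵ Z` of compact objects
has a compact pullback. -/
def IsCoherentObject (X : E) : Prop :=
  IsCompactObject X ∧
    ∀ ⦃W Y Z : E⦄ (fst : W ⟶ Y) (snd : W ⟶ Z) (f : Y ⟶ X) (g : Z ⟶ X),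
      IsPullback fst snd f g → IsCompactObject Y → IsCompactObject Z → IsCompactObject W

variable (E) in
/-- A topos is coherent if it contains a full subcategory of compact generators that is closed
under finite limits. -/
def IsCoherentTopos : Prop :=
  ∃ K : ObjectProperty E, (∀ X, K X → IsCompactObject X) ∧ K.IsSeparating ∧
    ∀ (D : Type) [SmallCategory D] [FinCategory D], K.IsClosedUnderLimitsOfShape D

end Topos

/-! ### Properties of the subtopos of presheaves given by a Grothendieck topology

The subtopos of the presheaf topos on `P` corresponding to a Grothendieck topology `J` is the
full subcategory of `J`-sheaves. -/

section Subtopos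

variable {P : Type u} [PartialOrder P]

/-- The topos of sheaves for `J` is a closed subtopos of the presheaf topos: there is a
subterminal presheaf `U` such that the sheaves are precisely the presheaves `F` for which the
projection `F ⨯ U ⟶ U` is an isomorphism. -/
def IsClosedSubtopos (J : GrothendieckTopology P) : Prop :=
  ∃ U : Pᵒᵖ ⥤ Type u, IsSubterminal U ∧
    ∀ F : Pᵒᵖ ⥤ Type u, Presheaf.IsSheaf J F ↔ IsIso (prod.snd : F ⨯ U ⟶ U)

/-- The topos of sheaves for `J` is a coherent subtopos of the presheaf topos: both toposes are
coherent, and the inverse image functor of the inclusion (sheafification) preserves coherent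
objects. -/
def IsCoherentSubtopos (J : GrothendieckTopology P) : Prop :=
  IsCoherentTopos (Pᵒᵖ ⥤ Type u) ∧ IsCoherentTopos (Sheaf J (Type u)) ∧
    ∀ F : Pᵒᵖ ⥤ Type u, IsCoherentObject F →
      IsCoherentObject ((presheafToSheaf J (Type u)).obj F)

end Subtopos

/-! ### The cardinalities attached to a poset `P` -/

section Cardinalities

variable (P : Type u) [PartialOrder P]

/-- Cardinality of the set of closed subtoposes. -/
noncomputable def cl : Cardinal.{u} := #{J : GrothendieckTopology P // IsClosedSubtopos J}

/-- Cardinality of the set of coherent subtoposes. -/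
noncomputable def coh : Cardinal.{u} := #{J : GrothendieckTopology P // IsCoherentSubtopos J}

/-- Cardinality of the set of subtoposes with enough points. -/
noncomputable def ep : Cardinal.{u} :=
  #{J : GrothendieckTopology P // GrothendieckTopology.HasEnoughPoints.{u} J}

/-- Cardinality of the set of Grothendieck topologies. -/
noncomputable def gt : Cardinal.{u} := #(GrothendieckTopology P)

end Cardinalities

end PosetTopos

/-!
In a well-quasi-order every upper set is the upper closure of a finite set. Applied to the poset of
filters on `ℕᵒᵈ`, which is `ℕ∞`, this makes the Scott topology Noetherian, so that every open set is
compact and the patch and strong topologies have the same generators up to intersections. Applied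
to `Pᵒᵈ` it bounds the number of lower sets and of sieves of `P`, and shows that all sieves are
finitely generated.

A subset `S` of `P` gives a Grothendieck topology `J_S`, in which a sieve covers if it contains all
elements of `S` below its target. The map `S ↦ J_S` is injective, and `Sh(P, J_S)` is equivalent to
`PSh(S)` by restriction. The closed subtoposes are the `J_S` with `S` an upper set, hence countable
in number. A presheaf is compact if and only if it is finitely generated; since sieves are finitely
generated and `P` has finite meets, these presheaves are closed under finite limits, so they are
also the coherent ones. If the inclusion of `S` has a right adjoint, as for infinite `S ⊆ ℕᵒᵈ`,
then restriction to `S` preserves finite generation, and `Sh(P, J_S)` is a coherent subtopos.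
-/

namespace PosetTopos

/-! ### The Scott topology of a well-quasi-order -/

section Scott

variable {α : Type*} [PartialOrder α]

theorem exists_finset_upperClosure_eq [WellQuasiOrderedLE α] (U : UpperSet α) :
    ∃ t : Finset α, upperClosure (t : Set α) = U := by
  have hfin : {a | Minimal (· ∈ U) a}.Finite :=
    WellQuasiOrderedLE.finite_of_isAntichain (setOfPred_minimal_antichain _)
  refine ⟨hfin.toFinset, SetLike.ext fun a => ?_⟩
  simp only [mem_upperClosure, Set.Finite.coe_toFinset]
  constructor
  · rintro ⟨m, hm, hma⟩
    exact U.upper hma hm.prop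
  · intro ha
    obtain ⟨m, hma, hm⟩ := exists_minimal_le_of_wellFoundedLT (· ∈ U) a ha
    exact ⟨m, hm, hma⟩

variable [TopologicalSpace α]

theorem noetherianSpace_of_isScott [WellQuasiOrderedLE α] (D : Set (Set α))
    [Topology.IsScott α D] : TopologicalSpace.NoetherianSpace α := by
  refine (TopologicalSpace.noetherianSpace_iff_opens α).2 fun U => ?_
  have hupper {V : Set α} (hV : IsOpen V) : IsUpperSet V :=
    Topology.IsScott.isUpperSet_of_isOpen (D := D) hV
  obtain ⟨t, ht⟩ := exists_finset_upperClosure_eq ⟨(U : Set α), hupper U.isOpen⟩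
  have hU : (U : Set α) = ⋃ a ∈ (t : Set α), Set.Ici a := by
    rw [← coe_upperClosure, ht]
    rfl
  rw [hU]
  refine t.finite_toSet.isCompact_biUnion fun a _ => ?_
  refine isCompact_of_finite_subcover fun V hV hsub => ?_
  obtain ⟨i, hi⟩ := Set.mem_iUnion.1 (hsub Set.self_mem_Ici)
  exact ⟨{i}, by simpa using (hupper (hV i)).Ici_subset hi⟩

theorem quasiSober_of_isScott [Std.Total (α := α) (· ≤ ·)] [Topology.IsScott α Set.univ]
    (hlub : ∀ s : Set α, s.Nonempty → ∃ a, IsLUB s a) : QuasiSober α where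
  sober {S} hirr hS := by
    obtain ⟨a, ha⟩ := hlub S hirr.nonempty
    have hdir : DirectedOn (· ≤ ·) S := fun x hx y hy =>
      (total_of (· ≤ ·) x y).elim (fun h => ⟨y, hy, h, le_rfl⟩) fun h => ⟨x, hx, le_rfl, h⟩
    have haS : a ∈ S :=
      Topology.IsScott.dirSupClosed_of_isClosed hS subset_rfl hirr.nonempty hdir ha
    have hSa : S = Set.Iic a := Set.Subset.antisymm ha.1
      ((Topology.IsScott.isLowerSet_of_isClosed hS).Iic_subset haS)
    exact ⟨a, hSa ▸ Topology.IsScott.closure_singleton⟩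

end Scott

open scoped Topology in
theorem patchTopology_eq_strongTopology (X : Type u) [TopologicalSpace X]
    [TopologicalSpace.NoetherianSpace X] : patchTopology X = strongTopology X := by
  have hpatch {U : Set X} (hU : IsOpen U) : IsOpen[patchTopology X] U :=
    .basic _ (.inl ⟨hU, TopologicalSpace.NoetherianSpace.isCompact U⟩)
  have hpatch_compl {Z : Set X} (hZ : IsClosed Z) : IsOpen[patchTopology X] Z :=
    .basic _ (.inr ⟨hZ.isOpen_compl, TopologicalSpace.NoetherianSpace.isCompact Zᶜ⟩)
  refine le_antisymm (le_generateFrom ?_) (le_generateFrom ?_)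
  · rintro _ ⟨U, Z, hU, hZ, rfl⟩
    exact @IsOpen.inter _ (patchTopology X) _ _ (hpatch hU) (hpatch_compl hZ)
  · rintro s (h | h)
    · exact .basic _ h.1.isLocallyClosed
    · exact .basic _ (isOpen_compl_iff.1 h.1).isLocallyClosed

/-! ### Filters on the natural numbers with the opposite order -/

section Filters

open Order OrderDual

/-- The filter on `ℕᵒᵈ` of all natural numbers below an extended natural number. -/
def filterOfENat (k : ℕ∞) : PFilter ℕᵒᵈ :=
  IsPFilter.toPFilter (F := {m | ((ofDual m : ℕ) : ℕ∞) ≤ k}) <|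
    IsPFilter.of_def ⟨toDual 0, by simp⟩
      (fun a ha b hb => (le_total a b).elim (fun h => ⟨a, ha, le_refl a, h⟩)
        fun h => ⟨b, hb, h, le_refl b⟩)
      (fun {x y} hxy hx => show ((ofDual y : ℕ) : ℕ∞) ≤ k from
        le_trans (Nat.cast_le.2 (show ofDual y ≤ ofDual x from hxy)) hx)

theorem mem_filterOfENat {k : ℕ∞} {m : ℕ} : toDual m ∈ filterOfENat k ↔ (m : ℕ∞) ≤ k :=
  Iff.rfl

theorem filterOfENat_le_iff {k l : ℕ∞} : filterOfENat k ≤ filterOfENat l ↔ k ≤ l := by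
  refine ⟨fun h => ?_, fun h m hm => le_trans hm h⟩
  exact ENat.forall_natCast_le_iff_le.1 fun m hm => h (mem_filterOfENat.2 hm)

theorem filterOfENat_natCast (n : ℕ) : filterOfENat n = PFilter.principal (toDual n) :=
  SetLike.ext fun m => (Nat.cast_le : ((ofDual m : ℕ) : ℕ∞) ≤ n ↔ ofDual m ≤ n)

theorem coe_filterOfENat_top : (filterOfENat ⊤ : Set ℕᵒᵈ) = Set.univ :=
  Set.eq_univ_of_forall fun _ => le_top (α := ℕ∞)

theorem filterOfENat_surjective : Function.Surjective filterOfENat := by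
  intro F
  refine ⟨⨆ m : {m : ℕ // toDual m ∈ F}, (m : ℕ∞), SetLike.ext fun n => ?_⟩
  refine (mem_filterOfENat (m := ofDual n)).trans ⟨fun hn => ?_, fun hn => ?_⟩
  · by_contra hnF
    have hlt (m : {m : ℕ // toDual m ∈ F}) : m.1 < ofDual n :=
      not_le.1 fun h => hnF (PFilter.mem_of_le (x := toDual m.1) h m.2)
    obtain ⟨a, ha⟩ := F.nonempty
    obtain ⟨k, hk⟩ := Nat.exists_eq_succ_of_ne_zero (hlt ⟨ofDual a, ha⟩).ne_bot
    have hle : ((ofDual n : ℕ) : ℕ∞) ≤ k := hn.trans <|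
      iSup_le fun m => Nat.cast_le.2 (Nat.le_of_lt_succ (hk ▸ hlt m))
    exact (Nat.cast_le.1 hle).not_gt (hk ▸ k.lt_succ_self)
  · exact le_iSup (fun m : {m : ℕ // toDual m ∈ F} => (m : ℕ∞)) ⟨ofDual n, hn⟩

/-- The poset of filters on `ℕᵒᵈ` is isomorphic to `ℕ∞`. -/
noncomputable def filterOrderIso : PFilter ℕᵒᵈ ≃o ℕ∞ :=
  (RelIso.ofSurjective (OrderEmbedding.ofMapLEIff filterOfENat fun _ _ => filterOfENat_le_iff)
    filterOfENat_surjective).symm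

theorem filterOrderIso_principal (n : ℕ) :
    filterOrderIso (PFilter.principal (toDual n)) = n := by
  rw [← filterOfENat_natCast]
  exact filterOrderIso.apply_symm_apply n

instance (P : Type*) [PartialOrder P] : Topology.IsScott (PFilter P) Set.univ := ⟨rfl⟩

instance : WellQuasiOrderedLE (PFilter ℕᵒᵈ) :=
  filterOrderIso.wellQuasiOrderedLE_iff.2 inferInstance

instance : Std.Total (α := PFilter ℕᵒᵈ) (· ≤ ·) :=
  filterOrderIso.toRelEmbedding.total

theorem exists_isLUB_filter (s : Set (PFilter ℕᵒᵈ)) : ∃ F, IsLUB s F :=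
  ⟨_, filterOrderIso.isLUB_image.1 (isLUB_sSup _)⟩

instance : TopologicalSpace.NoetherianSpace (PFilter ℕᵒᵈ) :=
  noetherianSpace_of_isScott Set.univ

instance : SpectralSpace (PFilter ℕᵒᵈ) where
  toQuasiSober := quasiSober_of_isScott fun s _ => exists_isLUB_filter s
  inter_isCompact _ _ _ _ _ _ := TopologicalSpace.NoetherianSpace.isCompact _

end Filters

/-! ### Invariance under equivalence -/

section Transfer

universe u'

variable {E : Type u} [Category.{v} E] {E' : Type u'} [Category.{v} E']

theorem IsCompactObject.of_iso {X Y : E} (e : X ≅ Y) (hX : IsCompactObject X) :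
    IsCompactObject Y := by
  intro ι Z f hf
  obtain ⟨s, hs⟩ := hX (fun i => f i ≫ e.inv) fun W g h hgh =>
    (cancel_epi e.inv).1 <| hf _ _ fun i => by simpa using hgh i
  refine ⟨s, fun W g h hgh => (cancel_epi e.hom).1 <| hs _ _ fun i => by simpa using hgh i⟩

theorem epimorphicFamily_map_iff (F : E ⥤ E') [F.IsEquivalence] {X : E} {ι : Type v} {Y : ι → E}
    (f : ∀ i, Y i ⟶ X) : EpimorphicFamily (fun i => F.map (f i)) ↔ EpimorphicFamily f := by
  constructor
  · intro H Z g h hgh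
    exact F.map_injective (H _ _ fun i => by rw [← F.map_comp, ← F.map_comp, hgh])
  · intro H Z g h hgh
    let e := F.objObjPreimageIso Z
    obtain ⟨g', hg⟩ := F.map_surjective (g ≫ e.inv)
    obtain ⟨h', hh⟩ := F.map_surjective (h ≫ e.inv)
    have := H g' h' fun i => F.map_injective (by
      rw [F.map_comp, F.map_comp, hg, hh, ← Category.assoc, hgh, Category.assoc])
    rw [← cancel_mono e.inv, ← hg, ← hh, this]

theorem IsCompactObject.of_map (F : E ⥤ E') [F.IsEquivalence] {X : E}
    (hX : IsCompactObject (F.obj X)) : IsCompactObject X := by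
  intro ι Y f hf
  obtain ⟨s, hs⟩ := hX _ ((epimorphicFamily_map_iff F f).2 hf)
  exact ⟨s, (epimorphicFamily_map_iff F fun i : {i : ι // i ∈ s} => f i.1).1 hs⟩

theorem isCompactObject_map_iff (F : E ⥤ E') [F.IsEquivalence] {X : E} :
    IsCompactObject (F.obj X) ↔ IsCompactObject X :=
  ⟨.of_map F, fun hX => .of_map F.inv (hX.of_iso (F.asEquivalence.unitIso.app X))⟩

theorem IsCoherentObject.of_map (F : E ⥤ E') [F.IsEquivalence] {X : E}
    (hX : IsCoherentObject (F.obj X)) : IsCoherentObject X := by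
  refine ⟨.of_map F hX.1, fun W Y Z fst snd f g sq hY hZ => .of_map F ?_⟩
  exact hX.2 _ _ _ _ (sq.map F) ((isCompactObject_map_iff F).2 hY)
    ((isCompactObject_map_iff F).2 hZ)

theorem IsCoherentTopos.of_isEquivalence (F : E ⥤ E') [F.IsEquivalence] (h : IsCoherentTopos E') :
    IsCoherentTopos E := by
  obtain ⟨K, hcompact, hsep, hlim⟩ := h
  refine ⟨K.isoClosure.inverseImage F, ?_, ?_, fun D _ _ => ?_⟩
  · rintro X ⟨Y, hY, ⟨e⟩⟩
    exact .of_map F ((hcompact Y hY).of_iso e.symm)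
  · refine (hsep.of_equivalence F.asEquivalence.symm).of_le ?_
    rintro _ ⟨Y, hY⟩
    exact ⟨Y, hY, ⟨F.asEquivalence.counitIso.app Y⟩⟩
  · have : K.isoClosure.IsClosedUnderLimitsOfShape D := ⟨by
      rw [ObjectProperty.limitsOfShape_isoClosure]
      exact (hlim D).limitsOfShape_le.trans K.le_isoClosure⟩
    infer_instance

end Transfer

/-! ### Compact presheaves -/

section Presheaves

open Opposite

section

universe w

variable {C : Type u} [Category.{v} C] {F : Cᵒᵖ ⥤ Type w}

theorem isGeneratedBy_iff_forall_mem_iff {G : Subfunctor F} {ι : Type*} {X : ι → Cᵒᵖ}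
    {x : ∀ i, F.obj (X i)} :
    G.IsGeneratedBy x ↔
      ∀ U (z : F.obj U), z ∈ G.obj U ↔ ∃ (i : ι) (f : X i ⟶ U), F.map f (x i) = z := by
  rw [Subfunctor.isGeneratedBy_iff, eq_comm, Subfunctor.ext_iff, funext_iff]
  simp only [Set.ext_iff, Subfunctor.iSup_obj, Set.mem_iUnion, Subfunctor.ofSection_obj,
    Set.mem_ofPred_eq]

theorem presheafIsGeneratedBy_iff {ι : Type*} {X : ι → Cᵒᵖ} {x : ∀ i, F.obj (X i)} :
    PresheafIsGeneratedBy F x ↔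
      ∀ U (z : F.obj U), ∃ (i : ι) (f : X i ⟶ U), F.map f (x i) = z := by
  simp [isGeneratedBy_iff_forall_mem_iff]

theorem presheafIsFinite_comp_of_adjunction {D : Type*} [Category* D] {L : D ⥤ C} {R : C ⥤ D}
    (adj : L ⊣ R) [PresheafIsFinite F] : PresheafIsFinite (L.op ⋙ F) := by
  obtain ⟨ι, _, X, x, ⟨hgen⟩⟩ := ‹PresheafIsFinite F›.exists_isGeneratedBy
  have hgen' : PresheafIsGeneratedBy (L.op ⋙ F) (X := fun i => op (R.obj (X i).unop))
      fun i => F.map (adj.counit.app (X i).unop).op (x i) := by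
    refine presheafIsGeneratedBy_iff.2 fun U z => ?_
    obtain ⟨i, f, rfl⟩ := presheafIsGeneratedBy_iff.1 hgen _ z
    refine ⟨i, (adj.homEquiv U.unop (X i).unop f.unop).op, ?_⟩
    have hf : (adj.counit.app (X i).unop).op ≫
        (L.map (adj.homEquiv U.unop (X i).unop f.unop)).op = f :=
      congrArg Quiver.Hom.op <|
        (adj.homEquiv_counit _ _ _).symm.trans ((adj.homEquiv _ _).symm_apply_apply f.unop)
    exact (ConcreteCategory.congr_hom (F.map_comp _ _) (x i)).symm.trans <|
      ConcreteCategory.congr_hom (congrArg F.map hf) (x i)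
  exact hgen'.isFinite

end

/-- Every sieve of `C`, seen as a subfunctor of a representable presheaf, is generated by finitely
many morphisms. This makes the finitely generated presheaves closed under finite limits. -/
class HasFiniteSieves (C : Type u) [Category.{v} C] : Prop where
  isFinite_subfunctor_yoneda (X : C) (R : Subfunctor (yoneda.obj X)) : R.IsFinite

instance (P : Type*) [PartialOrder P] [WellQuasiOrderedLE Pᵒᵈ] : HasFiniteSieves P where
  isFinite_subfunctor_yoneda p R := by
    obtain ⟨t, ht⟩ := exists_finset_upperClosure_eq (α := Pᵒᵈ)
      ⟨{q | ∃ f : OrderDual.ofDual q ⟶ p, f ∈ R.obj (op (OrderDual.ofDual q))}, by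
        rintro q r hqr ⟨f, hf⟩
        exact ⟨_, R.map (homOfLE hqr).op hf⟩⟩
    have hmem (q : P) : (∃ f : q ⟶ p, f ∈ R.obj (op q)) ↔ ∃ r ∈ t, q ≤ OrderDual.ofDual r := by
      have h := SetLike.ext_iff.1 ht (OrderDual.toDual q)
      rw [mem_upperClosure] at h
      exact h.symm
    choose f hf using fun r : t => (hmem (OrderDual.ofDual r.1)).2 ⟨r.1, r.2, le_rfl⟩
    have hgen : R.IsGeneratedBy (X := fun r : t => op (OrderDual.ofDual r.1)) f := by
      refine isGeneratedBy_iff_forall_mem_iff.2 fun U g => ⟨fun hg => ?_, ?_⟩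
      · obtain ⟨r, hr, hUr⟩ := (hmem U.unop).1 ⟨g, hg⟩
        exact ⟨⟨r, hr⟩, (homOfLE hUr).op, Subsingleton.elim (α := U.unop ⟶ p) _ _⟩
      · rintro ⟨r, h, rfl⟩
        exact R.map h (hf r)
    exact hgen.isFinite

section

variable {C : Type u} [Category.{v} C] [HasFiniteSieves C] {J : Type*} {F : Cᵒᵖ ⥤ Type v}
  {G : J → Cᵒᵖ ⥤ Type v}

theorem exists_finite_generators_of_jointly_injective (π : ∀ j, F ⟶ G j)
    (hπ : ∀ U (z z' : F.obj U), (∀ j, (π j).app U z = (π j).app U z') → z = z')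
    {c : Cᵒᵖ} (y : ∀ j, (G j).obj c) :
    ∃ (κ : Type) (_ : Finite κ) (X : κ → Cᵒᵖ) (x : ∀ k, F.obj (X k)),
      ∀ U (z : F.obj U) (f : c ⟶ U), (∀ j, (π j).app U z = (G j).map f (y j)) →
        ∃ (k : κ) (g : X k ⟶ U), F.map g (x k) = z := by
  -- The sieve of all morphisms along which the family `y` restricts to an element of `F`.
  let R : Subfunctor (yoneda.obj c.unop) :=
    { obj U := {f | ∃ z : F.obj U, ∀ j, (π j).app U z = (G j).map f.op (y j)}
      map := by
        rintro U V g f ⟨z, hz⟩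
        refine ⟨F.map g z, fun j => ?_⟩
        rw [NatTrans.naturality_apply, hz, ← ConcreteCategory.comp_apply, ← (G j).map_comp]
        rfl }
  obtain ⟨κ, hκ, X, f, ⟨hgen⟩⟩ := HasFiniteSieves.isFinite_subfunctor_yoneda c.unop R
  choose x hx using hgen.mem
  refine ⟨κ, hκ, X, x, fun U z f' hz => ?_⟩
  obtain ⟨k, g, hg⟩ := (isGeneratedBy_iff_forall_mem_iff.1 hgen U f'.unop).1 ⟨z, hz⟩
  refine ⟨k, g, hπ U _ _ fun j => ?_⟩
  rw [NatTrans.naturality_apply, hx, hz, ← ConcreteCategory.comp_apply, ← (G j).map_comp]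
  exact ConcreteCategory.congr_hom (congrArg (G j).map (congrArg Quiver.Hom.op hg)) (y j)

theorem presheafIsFinite_of_jointly_injective [HasFiniteProducts C] [Finite J]
    [∀ j, PresheafIsFinite (G j)] (π : ∀ j, F ⟶ G j)
    (hπ : ∀ U (z z' : F.obj U), (∀ j, (π j).app U z = (π j).app U z') → z = z') :
    PresheafIsFinite F := by
  choose ι hι X x hx using fun j => ‹∀ j, PresheafIsFinite (G j)› j |>.exists_isGeneratedBy
  -- A section of `F` is determined by its images in the `G j`, each a restriction of a generator of
  -- `G j`, so jointly restrictions of a family `y t` over the product of the domains.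
  let c (t : ∀ j, ι j) : C := ∏ᶜ fun j => (X j (t j)).unop
  let y (t : ∀ j, ι j) (j : J) : (G j).obj (op (c t)) :=
    (G j).map (Pi.π (fun j => (X j (t j)).unop) j).op (x j (t j))
  choose κ hκ X' x' hx' using fun t => exists_finite_generators_of_jointly_injective π hπ (y t)
  have hgen : PresheafIsGeneratedBy F (fun i : Σ t, κ t => x' i.1 i.2) := by
    refine presheafIsGeneratedBy_iff.2 fun U z => ?_
    choose t f hf using fun j => presheafIsGeneratedBy_iff.1 (hx j).some U ((π j).app U z)
    obtain ⟨k, g, hg⟩ := hx' t U z (Pi.lift fun j => (f j).unop).op fun j => by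
      rw [← hf, ← ConcreteCategory.comp_apply, ← (G j).map_comp, ← op_comp, Pi.lift_π,
        Quiver.Hom.op_unop]
    exact ⟨⟨t, k⟩, g, hg⟩
  exact hgen.isFinite

end

section

variable {C : Type v} [SmallCategory C]

theorem epimorphicFamily_iff_iSup_range_eq_top {X : Cᵒᵖ ⥤ Type v} {ι : Type v}
    {Y : ι → Cᵒᵖ ⥤ Type v} (f : ∀ i, Y i ⟶ X) :
    EpimorphicFamily f ↔ ⨆ i, Subfunctor.range (f i) = ⊤ := by
  constructor
  · intro H
    set G := ⨆ i, Subfunctor.range (f i)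
    have hle (i : ι) : Subfunctor.range (f i) ≤ G := le_iSup (fun i => Subfunctor.range (f i)) i
    have : Epi G.ι := ⟨fun g h hgh => H _ _ fun i => by
      rw [← Subfunctor.lift_ι (f i) (hle i), Category.assoc, hgh, Category.assoc]⟩
    rw [← Subfunctor.range_ι G, Subfunctor.range_eq_top]
  · intro H Z g h hgh
    ext U x
    obtain ⟨i, y, rfl⟩ : ∃ i, x ∈ (Subfunctor.range (f i)).obj U := by
      simpa using (congrFun (congrArg Subfunctor.obj H) U).ge (Set.mem_univ x)
    exact ConcreteCategory.congr_hom (NatTrans.congr_app (hgh i) U) y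

theorem isCompactObject_iff_presheafIsFinite {F : Cᵒᵖ ⥤ Type v} :
    IsCompactObject F ↔ PresheafIsFinite F := by
  constructor
  · intro hF
    let ι := Σ U : Cᵒᵖ, F.obj U
    have hgen : PresheafIsGeneratedBy F (fun i : ι => i.2) :=
      presheafIsGeneratedBy_iff.2 fun U z => ⟨⟨U, z⟩, 𝟙 U, by simp⟩
    obtain ⟨s, hs⟩ := hF (ι := ι) (fun i => yonedaEquiv.symm i.2) <| by
      simpa only [epimorphicFamily_iff_iSup_range_eq_top, ← Subfunctor.ofSection_eq_range]
        using hgen.iSup_eq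
    simp only [epimorphicFamily_iff_iSup_range_eq_top, ← Subfunctor.ofSection_eq_range] at hs
    exact ((⊤ : Subfunctor F).isGeneratedBy_iff _).2 hs |>.isFinite
  · intro hF ι Y f hf
    rw [epimorphicFamily_iff_iSup_range_eq_top] at hf
    obtain ⟨κ, _, X, x, ⟨hgen⟩⟩ := hF.exists_isGeneratedBy
    have hmem (k : κ) : ∃ i, x k ∈ (Subfunctor.range (f i)).obj (X k) := by
      simpa using (congrFun (congrArg Subfunctor.obj hf) (X k)).ge (Set.mem_univ (x k))
    choose i hi using hmem
    classical
    refine ⟨(Set.finite_range i).toFinset, ?_⟩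
    rw [epimorphicFamily_iff_iSup_range_eq_top, eq_top_iff, ← hgen.iSup_eq, iSup_le_iff]
    intro k
    refine ((Subfunctor.ofSection_le_iff _ _).2 (hi k)).trans ?_
    exact le_iSup (fun j : {j // j ∈ (Set.finite_range i).toFinset} => Subfunctor.range (f j.1))
      ⟨i k, by simp⟩

theorem isSeparating_isCompactObject :
    ObjectProperty.IsSeparating (IsCompactObject (E := Cᵒᵖ ⥤ Type v)) := by
  intro X Y f g h
  ext ⟨p⟩ x
  have := congrArg yonedaEquiv (h (yoneda.obj p)
    (isCompactObject_iff_presheafIsFinite.2 inferInstance) (yonedaEquiv.symm x))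
  simpa [yonedaEquiv_comp] using this

variable [HasFiniteProducts C] [HasFiniteSieves C]

instance isClosedUnderLimitsOfShape_isCompactObject (D : Type) [SmallCategory D] [FinCategory D] :
    ObjectProperty.IsClosedUnderLimitsOfShape (IsCompactObject (E := Cᵒᵖ ⥤ Type v)) D where
  limitsOfShape_le := by
    rintro X ⟨h⟩
    have (j : D) : PresheafIsFinite (h.diag.obj j) :=
      isCompactObject_iff_presheafIsFinite.1 (h.prop_diag_obj j)
    refine isCompactObject_iff_presheafIsFinite.2 <|
      presheafIsFinite_of_jointly_injective h.π.app fun U z z' hz => ?_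
    exact (Types.isLimitEquivSections
      (isLimitOfPreserves ((evaluation _ _).obj U) h.isLimit)).injective (Subtype.ext (funext hz))

variable (C) in
theorem isCoherentTopos_presheaf : IsCoherentTopos (Cᵒᵖ ⥤ Type v) :=
  ⟨IsCompactObject, fun _ => id, isSeparating_isCompactObject, fun _ _ _ => inferInstance⟩

theorem isCoherentObject_iff_presheafIsFinite {F : Cᵒᵖ ⥤ Type v} :
    IsCoherentObject F ↔ PresheafIsFinite F := by
  rw [← isCompactObject_iff_presheafIsFinite]
  refine ⟨fun h => h.1, fun h => ⟨h, fun W Y Z fst snd f g sq hY hZ => ?_⟩⟩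
  refine ObjectProperty.prop_of_isLimit _ sq.isLimit ?_
  rintro (_ | _ | _)
  exacts [h, hY, hZ]

end

end Presheaves

/-! ### The Grothendieck topology attached to a subset -/

section SubsetTopology

open Opposite

variable {P : Type u} [PartialOrder P]

/-- The Grothendieck topology on `P` attached to a subset `S`: a sieve on `p` is covering if it
contains all elements of `S` below `p`. -/
def subsetTopology (S : Set P) : GrothendieckTopology P where
  sieves p := {R | ∀ ⦃q : P⦄ (f : q ⟶ p), q ∈ S → R f}
  top_mem' _ _ _ _ := trivial
  pullback_stable' _ _ _ f hR _ g hq := hR (g ≫ f) hq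
  transitive' p R hR R' hR' q f hq := by
    simpa using hR' (hR f hq) (𝟙 q) hq

theorem mem_subsetTopology {S : Set P} {p : P} {R : Sieve p} :
    R ∈ subsetTopology S p ↔ ∀ ⦃q : P⦄ (f : q ⟶ p), q ∈ S → R f :=
  Iff.rfl

theorem subsetTopology_injective : Function.Injective (subsetTopology (P := P)) := by
  intro S T h
  ext p
  let R : Sieve p :=
    { arrows := fun q _ => q ≠ p
      downward_closed := fun {q r} f hq g hr =>
        hq ((leOfHom f).antisymm (hr ▸ leOfHom g)) }
  have key (S : Set P) : p ∈ S ↔ R ∉ subsetTopology S p := by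
    rw [mem_subsetTopology]
    refine ⟨fun hp hR => hR (𝟙 p) hp rfl, fun hR => ?_⟩
    by_contra hp
    exact hR fun q _ hq hqp => hp (hqp ▸ hq)
  rw [key, key, h]

/-- The point of the site `(P, subsetTopology S)` given by an element of `S`. Its fibre functor is
evaluation at that element. -/
noncomputable def subsetPoint {S : Set P} (s : S) :
    GrothendieckTopology.Point.{u} (subsetTopology S) where
  fiber := shrinkYoneda.{u}.flip.obj (op s.1)
  jointly_surjective {U} R hR x := by
    obtain ⟨x, rfl⟩ := shrinkYonedaObjObjEquiv.symm.surjective x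
    exact ⟨_, x, hR x s.2, shrinkYonedaObjObjEquiv.symm (𝟙 _),
      shrinkYonedaObjObjEquiv.injective (Subsingleton.elim _ _)⟩

instance (S : Set P) : GrothendieckTopology.HasEnoughPoints.{u} (subsetTopology S) := by
  refine ⟨.ofObj subsetPoint, inferInstance, .mk' fun X R hR q f hq => ?_⟩
  obtain ⟨Y, a, ha, b, hb⟩ := hR ⟨_, ⟨(⟨q, hq⟩ : S)⟩⟩ (shrinkYonedaObjObjEquiv.symm f)
  obtain ⟨b, rfl⟩ := shrinkYonedaObjObjEquiv.symm.surjective b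
  exact R.downward_closed ha b

section Restriction

variable {Q : Type u} [PartialOrder Q] (s : Q ↪o P)

instance : s.monotone.functor.Full where
  map_surjective f := ⟨homOfLE (s.le_iff_le.1 (leOfHom f)), Subsingleton.elim _ _⟩

instance : s.monotone.functor.IsCoverDense (subsetTopology (Set.range s)) where
  is_cover p := by
    rintro _ f ⟨q, rfl⟩
    exact ⟨⟨q, 𝟙 _, f, by simp⟩⟩

instance : s.monotone.functor.IsDenseSubsite ⊥ (subsetTopology (Set.range s)) where
  functorPushforward_mem_iff {p R} := by
    rw [mem_subsetTopology, GrothendieckTopology.bot_covering, ← Sieve.id_mem_iff_eq_top]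
    constructor
    · intro h
      obtain ⟨q, f, g, hf, -⟩ := h (𝟙 _) ⟨p, rfl⟩
      rw [← Subsingleton.elim (homOfLE (s.le_iff_le.1 (leOfHom g)) ≫ f) (𝟙 p)]
      exact R.downward_closed hf _
    · rintro h q f -
      exact ⟨p, 𝟙 _, f, h, Subsingleton.elim _ _⟩

/-- Restriction along an order embedding `s : Q ↪o P`, as a functor from the sheaves for the
topology attached to the range of `s` to the presheaves on `Q`. -/
noncomputable def sheafRestriction :
    Sheaf (subsetTopology (Set.range s)) (Type u) ⥤ (Qᵒᵖ ⥤ Type u) :=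
  s.monotone.functor.sheafPushforwardContinuous (Type u) ⊥ (subsetTopology (Set.range s)) ⋙
    sheafToPresheaf ⊥ (Type u)

instance : (sheafRestriction s).IsEquivalence := by
  have : (sheafToPresheaf (⊥ : GrothendieckTopology Q) (Type u)).IsEquivalence :=
    inferInstanceAs (sheafBotEquivalence _).functor.IsEquivalence
  unfold sheafRestriction
  infer_instance

/-- The restriction of the sheafification of a presheaf along `s` is its restriction along `s`. -/
noncomputable def sheafRestrictionSheafificationIso (F : Pᵒᵖ ⥤ Type u) :
    (sheafRestriction s).obj ((presheafToSheaf (subsetTopology (Set.range s)) (Type u)).obj F) ≅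
      s.monotone.functor.op ⋙ F :=
  (sheafToPresheaf ⊥ (Type u)).mapIso
    ((Functor.IsDenseSubsite.sheafEquivSheafificationCompatibility ⊥ (subsetTopology (Set.range s))
      s.monotone.functor (Type u)).app F).symm ≪≫
    (isoSheafify ⊥ (Presheaf.isSheaf_bot (s.monotone.functor.op ⋙ F))).symm

end Restriction

theorem isCoherentSubtopos_subsetTopology_range {P Q : Type u} [SemilatticeInf P] [OrderTop P]
    [WellQuasiOrderedLE Pᵒᵈ] [SemilatticeInf Q] [OrderTop Q] [WellQuasiOrderedLE Qᵒᵈ]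
    (s : Q ↪o P) {r : P → Q} (gc : GaloisConnection s r) :
    IsCoherentSubtopos (subsetTopology (Set.range s)) := by
  refine ⟨isCoherentTopos_presheaf P, .of_isEquivalence (sheafRestriction s)
    (isCoherentTopos_presheaf Q), fun F hF => .of_map (sheafRestriction s) ?_⟩
  have := isCoherentObject_iff_presheafIsFinite.1 hF
  have : PresheafIsFinite (s.monotone.functor.op ⋙ F) :=
    presheafIsFinite_comp_of_adjunction gc.adjunction
  exact isCoherentObject_iff_presheafIsFinite.2 <|
    presheafIsFinite_of_epi _ (sheafRestrictionSheafificationIso s F).inv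

theorem isCoherentSubtopos_subsetTopology_of_infinite {S : Set ℕᵒᵈ} (hS : S.Infinite) :
    IsCoherentSubtopos (subsetTopology S) := by
  classical
  let p (n : ℕ) : Prop := OrderDual.toDual n ∈ S
  have hp : (Set.ofPred p).Infinite := hS
  let s : ℕᵒᵈ ↪o ℕᵒᵈ := (OrderEmbedding.ofStrictMono _ (Nat.nth_strictMono hp)).dual
  have hs : Set.range s = S := Nat.range_nth_of_infinite hp
  rw [← hs]
  exact isCoherentSubtopos_subsetTopology_range s (Nat.gc_count_nth hp).dual

end SubsetTopology

/-! ### Closed subtoposes -/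

section ClosedSubtopos

open Opposite

theorem isIso_prod_snd_iff {C : Type v} [SmallCategory C] (F U : Cᵒᵖ ⥤ Type v) :
    IsIso (prod.snd : F ⨯ U ⟶ U) ↔
      ∀ p, Nonempty (U.obj p) → Nonempty (Unique (F.obj p)) := by
  constructor
  · rintro hiso ⟨p⟩ ⟨u⟩
    have huniq (a : yoneda.obj p ⟶ F) :
        a = yonedaEquiv.symm u ≫ inv (prod.snd : F ⨯ U ⟶ U) ≫ prod.fst := by
      have : prod.lift a (yonedaEquiv.symm u) =
          yonedaEquiv.symm u ≫ inv (prod.snd : F ⨯ U ⟶ U) := by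
        rw [IsIso.eq_comp_inv, prod.lift_snd]
      rw [← Category.assoc, ← this, prod.lift_fst]
    refine ⟨⟨⟨yonedaEquiv (yonedaEquiv.symm u ≫ inv (prod.snd : F ⨯ U ⟶ U) ≫ prod.fst)⟩,
      fun x => ?_⟩⟩
    exact yonedaEquiv.symm_apply_eq.1 (huniq _)
  · intro h
    replace h (p : Cᵒᵖ) (hp : Nonempty (U.obj p)) : Unique (F.obj p) := (h p hp).some
    let φ : U ⟶ F :=
      { app p := ↾fun u => (h p ⟨u⟩).default
        naturality p q f := by
          ext u
          exact ((h q ⟨U.map f u⟩).uniq _).symm }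
    refine ⟨prod.lift φ (𝟙 U), ?_, prod.lift_snd _ _⟩
    refine prod.hom_ext ?_ (by
      rw [Category.assoc, prod.lift_snd, Category.comp_id, Category.id_comp])
    ext p x
    have u := (prod.snd : F ⨯ U ⟶ U).app p x
    exact ((h p ⟨u⟩).uniq _).trans ((h p ⟨u⟩).uniq _).symm

variable {P : Type u} [PartialOrder P]

theorem isSheaf_subsetTopology_compl_iff (D : LowerSet P) (F : Pᵒᵖ ⥤ Type u) :
    Presheaf.IsSheaf (subsetTopology (D : Set P)ᶜ) F ↔
      ∀ p ∈ D, Nonempty (Unique (F.obj (op p))) := by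
  constructor
  · intro hF p hp
    have hbot : ⊥ ∈ subsetTopology (D : Set P)ᶜ p := fun q g hq =>
      hq (D.lower (leOfHom g) hp)
    exact ⟨(Types.isTerminalEquivUnique _).1
      (Sheaf.isTerminalOfBotCover (⟨F, hF⟩ : Sheaf _ _) p hbot)⟩
  · intro h
    rw [isSheaf_iff_isSheaf_of_type]
    intro p R hR
    by_cases hp : p ∈ D
    · intro x _
      obtain ⟨hup⟩ := h p hp
      refine ⟨default, fun q f hf => ?_, fun y _ => hup.uniq y⟩
      obtain ⟨huq⟩ := h q (D.lower (leOfHom f) hp)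
      exact Subsingleton.elim _ _
    · obtain rfl : R = ⊤ := Sieve.id_mem_iff_eq_top.1 (hR (𝟙 p) hp)
      exact Presieve.isSheafFor_top _

/-- The lower set of those elements of `P` at which a presheaf is inhabited. -/
def support (U : Pᵒᵖ ⥤ Type u) : LowerSet P where
  carrier := {p | Nonempty (U.obj (op p))}
  lower' _ _ h := fun ⟨u⟩ => ⟨U.map (homOfLE h).op u⟩

theorem mem_support {U : Pᵒᵖ ⥤ Type u} {p : P} : p ∈ support U ↔ Nonempty (U.obj (op p)) :=
  Iff.rfl

/-- The subterminal presheaf on `P` with a given support. -/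
def subterminalOfLowerSet (D : LowerSet P) : Pᵒᵖ ⥤ Type u where
  obj p := ULift (PLift (p.unop ∈ D))
  map f := ↾fun x => ⟨⟨D.lower (leOfHom f.unop) x.down.down⟩⟩

theorem isSubterminal_subterminalOfLowerSet (D : LowerSet P) :
    IsSubterminal (subterminalOfLowerSet D) := by
  intro Z f g
  ext p x
  exact Subsingleton.elim (α := ULift (PLift (p.unop ∈ D))) _ _

theorem support_subterminalOfLowerSet (D : LowerSet P) :
    support (subterminalOfLowerSet D) = D :=
  SetLike.ext fun _ => mem_support.trans ⟨fun ⟨x⟩ => x.down.down, fun h => ⟨⟨⟨h⟩⟩⟩⟩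

theorem isSheaf_subsetTopology_compl_support_iff (U F : Pᵒᵖ ⥤ Type u) :
    Presheaf.IsSheaf (subsetTopology (support U : Set P)ᶜ) F ↔
      IsIso (prod.snd : F ⨯ U ⟶ U) := by
  rw [isSheaf_subsetTopology_compl_iff, isIso_prod_snd_iff]
  exact ⟨fun h p => h p.unop, fun h p => h (op p)⟩

theorem isClosedSubtopos_iff {J : GrothendieckTopology P} :
    IsClosedSubtopos J ↔ ∃ D : LowerSet P, subsetTopology (D : Set P)ᶜ = J := by
  constructor
  · rintro ⟨U, -, hU⟩
    refine ⟨support U, topology_eq_iff_same_sheaves.2 fun F => ?_⟩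
    rw [← isSheaf_iff_isSheaf_of_type, ← isSheaf_iff_isSheaf_of_type, hU,
      isSheaf_subsetTopology_compl_support_iff]
  · rintro ⟨D, rfl⟩
    refine ⟨_, isSubterminal_subterminalOfLowerSet D, fun F => ?_⟩
    rw [← isSheaf_subsetTopology_compl_support_iff, support_subterminalOfLowerSet]

variable (P) in
theorem cl_eq_mk_lowerSet : cl P = #(LowerSet P) := by
  have hinj : Function.Injective fun D : LowerSet P => subsetTopology (D : Set P)ᶜ :=
    fun _ _ h => SetLike.coe_injective (compl_injective (subsetTopology_injective h))
  have hrange : {J : GrothendieckTopology P | IsClosedSubtopos J} =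
      Set.range fun D : LowerSet P => subsetTopology (D : Set P)ᶜ :=
    Set.ext fun _ => isClosedSubtopos_iff
  exact (congrArg (fun s : Set (GrothendieckTopology P) => #s) hrange).trans (mk_range_eq _ hinj)

end ClosedSubtopos

/-! ### Cardinalities -/

section Cardinality

theorem mk_infinite_sets (α : Type u) [Infinite α] : #{S : Set α // S.Infinite} = 2 ^ #α := by
  have hfin : #{S : Set α | S.Finite} < #(Set α) := by
    have hle : #{S : Set α | S.Finite} ≤ #(Finset α) :=
      mk_le_of_injective (f := fun S => S.2.toFinset) fun S T h =>
        Subtype.ext (Set.Finite.toFinset_inj.1 h)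
    calc #{S : Set α | S.Finite} ≤ #α := hle.trans_eq (mk_finset_of_infinite α)
      _ < #(Set α) := by rw [mk_set]; exact cantor _
  exact (mk_compl_of_infinite _ hfin).trans mk_set

instance (P : Type*) [PartialOrder P] [Countable P] [WellQuasiOrderedLE Pᵒᵈ] :
    Countable (LowerSet P) := by
  refine Function.Surjective.countable (α := Finset P)
    (f := fun t => lowerClosure (t : Set P)) fun D => ?_
  obtain ⟨t, ht⟩ := exists_finset_upperClosure_eq (α := Pᵒᵈ) ⟨{p | OrderDual.ofDual p ∈ D}, D.lower⟩
  exact ⟨t, SetLike.ext fun p => SetLike.ext_iff.1 ht (OrderDual.toDual p)⟩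

variable {P : Type u} [PartialOrder P]

instance [Countable P] [WellQuasiOrderedLE Pᵒᵈ] (p : P) : Countable (Sieve p) := by
  let domains (R : Sieve p) : LowerSet P :=
    ⟨{q | ∃ f : q ⟶ p, R f}, fun _ _ hqr ⟨f, hf⟩ =>
      ⟨homOfLE hqr ≫ f, R.downward_closed hf _⟩⟩
  have mem_domains {R : Sieve p} {q : P} (f : q ⟶ p) : R f ↔ q ∈ domains R :=
    ⟨fun hf => ⟨f, hf⟩, fun ⟨g, hg⟩ => Subsingleton.elim g f ▸ hg⟩
  refine Function.Injective.countable (f := domains) fun R R' h => ?_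
  ext q f
  rw [mem_domains, mem_domains, h]

variable (P) [Countable P] [WellQuasiOrderedLE Pᵒᵈ]

theorem gt_le_two_power_aleph0 : gt P ≤ 2 ^ ℵ₀ := by
  have hinj : Function.Injective fun (J : GrothendieckTopology P) =>
      {x : Σ p : P, Sieve p | x.2 ∈ J x.1} := fun J J' h => by
    ext p R
    exact Set.ext_iff.1 h ⟨p, R⟩
  calc gt P ≤ #(Set (Σ p : P, Sieve p)) := mk_le_of_injective hinj
    _ = 2 ^ #(Σ p : P, Sieve p) := mk_set
    _ ≤ 2 ^ ℵ₀ := power_le_power_left two_ne_zero mk_le_aleph0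

variable [Infinite P]

variable {P} in
theorem mk_grothendieckTopology_subtype {p : GrothendieckTopology P → Prop}
    (hp : ∀ S : Set P, S.Infinite → p (subsetTopology S)) : #{J // p J} = 2 ^ ℵ₀ := by
  refine le_antisymm ((mk_subtype_le p).trans (gt_le_two_power_aleph0 P)) ?_
  rw [← mk_eq_aleph0 P, ← mk_infinite_sets P]
  exact mk_le_of_injective (f := fun S => ⟨subsetTopology S.1, hp S.1 S.2⟩) fun S T h =>
    Subtype.ext (subsetTopology_injective (congrArg Subtype.val h))

theorem cl_eq_aleph0 : cl P = ℵ₀ := by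
  rw [cl_eq_mk_lowerSet]
  have : Infinite (LowerSet P) := .of_injective LowerSet.Iic LowerSet.Iic_injective
  exact mk_eq_aleph0 _

theorem gt_eq_two_power_aleph0 : gt P = 2 ^ ℵ₀ := by
  refine (gt_le_two_power_aleph0 P).antisymm ?_
  rw [← mk_grothendieckTopology_subtype (P := P) (p := fun _ => True) fun _ _ => trivial]
  exact mk_subtype_le _

theorem ep_eq_two_power_aleph0 : ep P = 2 ^ ℵ₀ :=
  mk_grothendieckTopology_subtype fun _ _ => inferInstance

theorem coh_orderDual_nat_eq_two_power_aleph0 : coh ℕᵒᵈ = 2 ^ ℵ₀ :=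
  mk_grothendieckTopology_subtype fun _ hS => isCoherentSubtopos_subsetTopology_of_infinite hS

end Cardinality

end PosetTopos

theorem mainTheorem10 :
    (∃ e : Order.PFilter ℕᵒᵈ ≃o ℕ∞,
      (∀ n : ℕ, e (Order.PFilter.principal (OrderDual.toDual n)) = (n : ℕ∞)) ∧
        (e.symm ⊤ : Set ℕᵒᵈ) = Set.univ) ∧
    #(Order.PFilter ℕᵒᵈ) = ℵ₀ ∧ #ℕᵒᵈ = ℵ₀ ∧ PosetTopos.cl ℕᵒᵈ = ℵ₀ ∧
    PosetTopos.gt ℕᵒᵈ = 2 ^ ℵ₀ ∧ PosetTopos.ep ℕᵒᵈ = 2 ^ ℵ₀ ∧ PosetTopos.coh ℕᵒᵈ = 2 ^ ℵ₀ ∧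
    SpectralSpace (Order.PFilter ℕᵒᵈ) ∧
    (∀ U : Set (Order.PFilter ℕᵒᵈ), IsOpen U → IsCompact U) ∧
    PosetTopos.patchTopology (Order.PFilter ℕᵒᵈ) =
      PosetTopos.strongTopology (Order.PFilter ℕᵒᵈ) :=
  ⟨⟨PosetTopos.filterOrderIso, PosetTopos.filterOrderIso_principal,
      PosetTopos.coe_filterOfENat_top⟩,
    (mk_congr PosetTopos.filterOrderIso.toEquiv).trans (mk_eq_aleph0 ℕ∞),
    mk_nat,
    PosetTopos.cl_eq_aleph0 ℕᵒᵈ,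
    PosetTopos.gt_eq_two_power_aleph0 ℕᵒᵈ,
    PosetTopos.ep_eq_two_power_aleph0 ℕᵒᵈ,
    PosetTopos.coh_orderDual_nat_eq_two_power_aleph0,
    inferInstance,
    fun U _ => TopologicalSpace.NoetherianSpace.isCompact U,
    PosetTopos.patchTopology_eq_strongTopology _⟩
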